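/- Let $n\ge 1$. Let $\mathcal{E}$ be the ring of pseudo-differential operators $P=\sum_{\ell\in\mathbb{Z}} a_\ell(x)\partial^\ell$ with $a_\ell\in\mathbb{C}[[x]]$ and $a_\ell=0$ for all large $\ell$, where $\partial=d/dx$ and $\partial^k\cdot a=\sum_{i\ge 0}\binom{k}{i}a^{(i)}\partial^{k-i}$ for all $k\in\mathbb{Z}$. Let $gl_n(\mathcal{E})$ be the ring of $n\times n$ matrices over $\mathcal{E}$, and let $G=I_n+gl_n(\mathbb{C}[[x]])[[\partial^{-1}]]\cdot\partial^{-1}\subset gl_n(\mathcal{E})$ be the group of monic operators of order $0$. The adjoint is $P^*=\sum_\ell\partial^\ell\cdot a_\ell(-x)$ for $P=\sum_\ell a_\ell(x)\partial^\ell\in\mathcal{E}$, and $(P^*)_{ij}=(P_{ji})^*$ for $P\in gl_n(\mathcal{E})$. The ring $\mathcal{E}$ acts on $\mathbb{C}((z))$ through the identification $\mathbb{C}((z))\cong\mathbb{C}((\partial^{-1}))=\mathcal{E}/\mathcal{E}x$, $f(z)\mapsto f(\partial^{-1})\partial^{-1}$, and so $gl_n(\mathcal{E})$ acts on $\mathbb{C}((z))^{\oplus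 n}$. Let $Gr_n(\mathbb{C})$ be the set of subspaces $W\subset\mathbb{C}((z))^{\oplus n}$ for which the natural map $\gamma_W:W\to\mathbb{C}((z))^{\oplus n}/\mathbb{C}[[z]]^{\oplus n}$ has finite-dimensional kernel and cokernel. The big cell of $Gr_n(\mathbb{C})$ is the set of those $W$ for which $\gamma_W$ is an isomorphism. For $f,g\in\mathbb{C}((z))^{\oplus n}$ let $\langle f,g\rangle_n$ be the coefficient of $z^{-1}$ in $\sum_i f_ig_i$, and let $W^\perp=\{f:\langle f,w\rangle_n=0\text{ for all }w\in W\}$. We say that $W$ in the big cell corresponds to $S\in G$ if $W=S^{-1}\cdot(\mathbb{C}[z^{-1}]^{\oplus n}\cdot z^{-1})$. Let $\Gamma_n$ be the group of diagonal $n\times n$ matrices over $\mathbb{C}[[z]]$ whose constant term is an invertible scalar matrix. It acts on $Gr_n(\mathbb{C})$, and $\overline{W}$ denotes the class of $W$ in $Z_n(\mathbb{C})=Gr_n(\mathbb{C})/\Gamma_n$. The big cell of $Z_n(\mathbb{C})$ consists of the classes of points of the big cell of $Gr_n(\mathbb{C})$; the class $\overline{W}^\perp:=\overline{W^\perp}$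 depends only on $\overline{W}$. A point of the big cell of $Z_n(\mathbb{C})$ corresponds to the Lax operator $\mathbf{L}\in gl_n(\mathcal{E})$ if it is $\overline{W}$ for some $W$ in the big cell that corresponds to some $S\in G$ with $\mathbf{L}=S\cdot I_n\partial\cdot S^{-1}$. **Theorem.** (1) Let $W$ be a point of the big cell of $Gr_n(\mathbb{C})$ that corresponds to $S\in G$. Then $W^\perp$ is a point of the big cell, $S^*$ is invertible with $(S^*)^{-1}\in G$, and $W^\perp$ corresponds to $(S^*)^{-1}$. (2) If a point $\overline{W}$ of the big cell of $Z_n(\mathbb{C})$ corresponds to the Lax operator $\mathbf{L}$, then $\overline{W}^\perp$ lies in the big cell of $Z_n(\mathbb{C})$ and corresponds to $\mathbf{L}^*$. -/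

import Mathlib

open PowerSeries

noncomputable section

/-- The `i`-th derivative on `ℂ⟦x⟧`. -/
def iterDeriv (i : ℕ) : ℂ⟦X⟧ →ₗ[ℂ] ℂ⟦X⟧ := (d⁄dX ℂ).toLinearMap ^ i

theorem iterDeriv_zero (a : ℂ⟦X⟧) : iterDeriv 0 a = a := rfl

theorem iterDeriv_add (i j : ℕ) (a : ℂ⟦X⟧) :
    iterDeriv (i + j) a = iterDeriv i (iterDeriv j a) := by
  simp [iterDeriv, pow_add]

theorem iterDeriv_one (i : ℕ) (hi : i ≠ 0) : iterDeriv i 1 = 0 := by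
  obtain ⟨j, rfl⟩ := Nat.exists_eq_succ_of_ne_zero hi
  rw [Nat.succ_eq_add_one, iterDeriv_add]
  simp [iterDeriv]

theorem iterDeriv_mul (s : ℕ) (a b : ℂ⟦X⟧) :
    iterDeriv s (a * b) =
      ∑ x ∈ Finset.HasAntidiagonal.antidiagonal s, (s.choose x.1) • (iterDeriv x.1 a * iterDeriv x.2 b) := by
  induction s with
  | zero => simp [iterDeriv_zero]
  | succ s ih =>
    rw [Finset.sum_antidiagonal_choose_succ_nsmul (fun i j => iterDeriv i a * iterDeriv j b) s,
      add_comm s 1, iterDeriv_add, ih, map_sum, ← Finset.sum_add_distrib]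
    refine Finset.sum_congr rfl fun x hx => ?_
    have hx' := Finset.HasAntidiagonal.mem_antidiagonal.mp hx
    have h1 : ∀ (i : ℕ) (c : ℂ⟦X⟧), iterDeriv (i + 1) c = (d⁄dX ℂ) (iterDeriv i c) := by
      intro i c; rw [add_comm, iterDeriv_add]; rfl
    have h2 : ∀ c : ℂ⟦X⟧, iterDeriv 1 c = (d⁄dX ℂ) c := fun c => rfl
    rw [map_nsmul, h2, h1, h1, Derivation.leibniz, smul_add,
      show s.choose x.2 = s.choose x.1 by rw [← hx', Nat.choose_symm_add]]
    simp only [smul_eq_mul, mul_comm]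

/-- Regrouping a finitely supported sum. -/
theorem finsum_fiber {α β M : Type*} [AddCommMonoid M] (f : α → M)
    (hf : (Function.support f).Finite) (φ : α → β) (t : β → Finset α)
    (ht : ∀ a b, a ∈ t b ↔ φ a = b) : ∑ᶠ b, ∑ a ∈ t b, f a = ∑ᶠ a, f a := by
  classical
  rw [finsum_eq_sum_of_support_subset (s := hf.toFinset) f (by simp),
    finsum_eq_sum_of_support_subset (s := hf.toFinset.image φ)]
  · rw [← Finset.sum_fiberwise_of_maps_to (g := φ) (t := hf.toFinset.image φ)
      (fun x hx => Finset.mem_image_of_mem _ hx)]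
    refine Finset.sum_congr rfl fun b _ => ?_
    symm
    refine Finset.sum_subset (fun x hx => ?_) (fun x hx hx' => ?_)
    · rw [Finset.mem_filter] at hx; exact (ht _ _).2 hx.2
    · by_contra hne
      exact hx' (Finset.mem_filter.2 ⟨by simpa using hne, (ht _ _).1 hx⟩)
  · intro b hb
    obtain ⟨a, ha, hne⟩ := Finset.exists_ne_zero_of_sum_ne_zero hb
    simp only [Finset.coe_image, Set.mem_image]
    exact ⟨a, by simpa using hne, (ht _ _).1 ha⟩

theorem finsum_fiber₂ {α β γ δ M : Type*} [AddCommMonoid M] (f : α → M)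
    (hf : (Function.support f).Finite) (φ : α → β × γ) (ψ : α → δ) (s : β → γ → Finset δ)
    (g : β → γ → δ → α) (h₁ : ∀ a, ψ a ∈ s (φ a).1 (φ a).2)
    (h₂ : ∀ a, g (φ a).1 (φ a).2 (ψ a) = a) (h₃ : ∀ b c, ∀ w ∈ s b c, φ (g b c w) = (b, c))
    (h₄ : ∀ b c, ∀ w ∈ s b c, ψ (g b c w) = w) :
    ∑ᶠ a, f a = ∑ᶠ (b) (c), ∑ w ∈ s b c, f (g b c w) := by
  classical
  have ht : ∀ (a : α) (y : β × γ), a ∈ (s y.1 y.2).image (g y.1 y.2) ↔ φ a = y := by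
    intro a y
    rw [Finset.mem_image]
    constructor
    · rintro ⟨w, hw, rfl⟩; exact h₃ _ _ w hw
    · rintro rfl; exact ⟨ψ a, h₁ a, h₂ a⟩
  rw [← finsum_fiber f hf φ _ ht, finsum_curry]
  · refine finsum_congr fun b => finsum_congr fun c => Finset.sum_image ?_
    intro w hw w' hw' h
    rw [← h₄ b c w hw, ← h₄ b c w' hw']
    exact congrArg ψ h
  · refine (hf.image φ).subset fun b hb => ?_
    obtain ⟨a, ha, hne⟩ := Finset.exists_ne_zero_of_sum_ne_zero hb
    exact ⟨a, hne, (ht _ _).1 ha⟩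

/-- Families `(a_k)` of elements of `ℂ⟦x⟧` with `a_k = 0` for all large `k`. -/
def psdoSubmodule : Submodule ℂ (ℤ → ℂ⟦X⟧) where
  carrier := {a | ∃ N : ℤ, ∀ k, N < k → a k = 0}
  zero_mem' := ⟨0, fun _ _ => rfl⟩
  add_mem' := by
    rintro a b ⟨N, hN⟩ ⟨M, hM⟩
    exact ⟨max N M, fun k hk => by
      simp [hN k (lt_of_le_of_lt (le_max_left _ _) hk), hM k (lt_of_le_of_lt (le_max_right _ _) hk)]⟩
  smul_mem' := by
    rintro c a ⟨N, hN⟩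
    exact ⟨N, fun k hk => by simp [hN k hk]⟩

/-- The ring of pseudo-differential operators `∑_k a_k(x) ∂^k`, `a_k = 0` for all large `k`,
with the coefficients written on the left. -/
def PsDO : Type := psdoSubmodule

namespace PsDO

instance : AddCommGroup PsDO := inferInstanceAs (AddCommGroup psdoSubmodule)

/-- The coefficient of `∂^k`. -/
def coeff (P : PsDO) (k : ℤ) : ℂ⟦X⟧ := P.1 k

theorem exists_bound (P : PsDO) : ∃ N : ℤ, ∀ k, N < k → P.coeff k = 0 := P.2

/-- The operator with given coefficients. -/
def mk (a : ℤ → ℂ⟦X⟧) (h : ∃ N : ℤ, ∀ k, N < k → a k = 0) : PsDO := ⟨a, h⟩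

@[simp] theorem coeff_mk (a : ℤ → ℂ⟦X⟧) (h) (k : ℤ) : (mk a h).coeff k = a k := rfl
@[simp] theorem coeff_zero (k : ℤ) : (0 : PsDO).coeff k = 0 := rfl
@[simp] theorem coeff_add (P Q : PsDO) (k : ℤ) : (P + Q).coeff k = P.coeff k + Q.coeff k := rfl

@[ext] theorem ext {P Q : PsDO} (h : ∀ k, P.coeff k = Q.coeff k) : P = Q :=
  Subtype.ext (funext h)

/-- By `∂^k · b = ∑_i binom(k, i) b^{(i)} ∂^{k-i}`, the term `a_k ∂^k · b_l ∂^l` contributes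
`binom(k, i) a_k b_l^{(i)}` to the coefficient of `∂^m`, where `l = m - k + i`. Here `x = (k, i)`. -/
def mulTerm (P Q : PsDO) (m : ℤ) (x : ℤ × ℕ) : ℂ⟦X⟧ :=
  Ring.choose x.1 x.2 • (P.coeff x.1 * iterDeriv x.2 (Q.coeff (m - x.1 + x.2)))

theorem mulTerm_support (P Q : PsDO) (m : ℤ) : (Function.support (mulTerm P Q m)).Finite := by
  obtain ⟨N, hN⟩ := P.exists_bound
  obtain ⟨M, hM⟩ := Q.exists_bound
  refine ((Set.finite_Icc (m - M) N).prod (Set.finite_Iic (N + M - m).toNat)).subset ?_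
  rintro ⟨k, i⟩ hx
  have h1 : k ≤ N := by
    by_contra h; exact hx (by simp [mulTerm, hN k (not_le.1 h)])
  have h2 : m - k + i ≤ M := by
    by_contra h; exact hx (by simp [mulTerm, hM _ (not_le.1 h)])
  simp only [Set.mem_prod, Set.mem_Icc, Set.mem_Iic]
  omega

theorem finsum_mulTerm_eq_zero {P Q : PsDO} {N M : ℤ} (hN : ∀ k, N < k → P.coeff k = 0)
    (hM : ∀ k, M < k → Q.coeff k = 0) (m : ℤ) (hm : N + M < m) :
    ∑ᶠ x : ℤ × ℕ, mulTerm P Q m x = 0 := by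
  rw [← finsum_zero (α := ℤ × ℕ)]
  refine finsum_congr fun x => ?_
  by_cases h : N < x.1
  · simp [mulTerm, hN _ h]
  · simp [mulTerm, hM (m - x.1 + x.2) (by omega)]

instance : Mul PsDO where
  mul P Q := mk (fun m => ∑ᶠ x : ℤ × ℕ, mulTerm P Q m x) (by
    obtain ⟨N, hN⟩ := P.exists_bound
    obtain ⟨M, hM⟩ := Q.exists_bound
    exact ⟨N + M, finsum_mulTerm_eq_zero hN hM⟩)

theorem coeff_mul (P Q : PsDO) (m : ℤ) :
    (P * Q).coeff m = ∑ᶠ x : ℤ × ℕ, mulTerm P Q m x := rfl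

theorem coeff_mul_eq_zero {P Q : PsDO} {N M : ℤ} (hN : ∀ k, N < k → P.coeff k = 0)
    (hM : ∀ k, M < k → Q.coeff k = 0) (m : ℤ) (hm : N + M < m) : (P * Q).coeff m = 0 :=
  finsum_mulTerm_eq_zero hN hM m hm

instance : One PsDO where
  one := mk (fun k => if k = 0 then 1 else 0) ⟨0, fun k hk => by simp [hk.ne']⟩

theorem coeff_one (k : ℤ) : (1 : PsDO).coeff k = if k = 0 then 1 else 0 := rfl

theorem one_mul' (P : PsDO) : 1 * P = P := by
  ext1 m
  rw [coeff_mul, finsum_eq_single _ ((0, 0) : ℤ × ℕ)]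
  · simp [mulTerm, coeff_one, iterDeriv_zero]
  · rintro ⟨k, i⟩ h
    by_cases hk : k = 0
    · subst hk
      have : i ≠ 0 := fun hi => h (by rw [hi])
      simp [mulTerm, Ring.choose_zero_pos ℤ (Nat.pos_of_ne_zero this)]
    · simp [mulTerm, coeff_one, hk]

theorem mul_one' (P : PsDO) : P * 1 = P := by
  ext1 m
  rw [coeff_mul, finsum_eq_single _ ((m, 0) : ℤ × ℕ)]
  · simp [mulTerm, coeff_one, iterDeriv_zero]
  · rintro ⟨k, i⟩ h
    by_cases hi : i = 0
    · subst hi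
      have : m - k ≠ 0 := fun hk => h (by rw [sub_eq_zero.1 hk])
      simp [mulTerm, coeff_one, this]
    · simp only [mulTerm, coeff_one]
      split_ifs
      · rw [iterDeriv_one _ hi]; simp
      · simp

theorem mul_add' (P Q R : PsDO) : P * (Q + R) = P * Q + P * R := by
  ext1 m
  rw [coeff_add, coeff_mul, coeff_mul, coeff_mul,
    ← finsum_add_distrib (mulTerm_support P Q m) (mulTerm_support P R m)]
  exact finsum_congr fun x => by simp [mulTerm, mul_add]

theorem add_mul' (P Q R : PsDO) : (P + Q) * R = P * R + Q * R := by
  ext1 m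
  rw [coeff_add, coeff_mul, coeff_mul, coeff_mul,
    ← finsum_add_distrib (mulTerm_support P R m) (mulTerm_support Q R m)]
  exact finsum_congr fun x => by simp [mulTerm, add_mul]

/-- The common quintuple expansion of both bracketings. -/
def assocTerm (P Q R : PsDO) (m : ℤ) (x : ℤ × ℤ × ℕ × ℕ × ℕ) : ℂ⟦X⟧ :=
  (Ring.choose x.1 (x.2.2.1 + x.2.2.2.1) * ((x.2.2.1 + x.2.2.2.1).choose x.2.2.1 : ℤ) *
      Ring.choose x.2.1 x.2.2.2.2) •
    (P.coeff x.1 * iterDeriv x.2.2.1 (Q.coeff x.2.1) *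
      iterDeriv (x.2.2.2.1 + x.2.2.2.2)
        (R.coeff (m - x.1 - x.2.1 + x.2.2.1 + x.2.2.2.1 + x.2.2.2.2)))

theorem assocTerm_support (P Q R : PsDO) (m : ℤ) :
    (Function.support (assocTerm P Q R m)).Finite := by
  obtain ⟨N, hN⟩ := P.exists_bound
  obtain ⟨M, hM⟩ := Q.exists_bound
  obtain ⟨K, hK⟩ := R.exists_bound
  have hf := Set.finite_Iic (N + M + K - m).toNat
  refine ((Set.finite_Icc (m - M - K) N).prod ((Set.finite_Icc (m - N - K) M).prod
    (hf.prod (hf.prod hf)))).subset ?_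
  rintro ⟨p, q, j, v, t⟩ hx
  have h1 : p ≤ N := by
    by_contra h; exact hx (by simp [assocTerm, hN p (not_le.1 h)])
  have h2 : q ≤ M := by
    by_contra h; exact hx (by simp [assocTerm, hM q (not_le.1 h)])
  have h3 : m - p - q + j + v + t ≤ K := by
    by_contra h; exact hx (by simp [assocTerm, hK _ (not_le.1 h)])
  simp only [Set.mem_prod, Set.mem_Icc, Set.mem_Iic]
  omega

theorem coeff_mul_mul_left (P Q R : PsDO) (m : ℤ) :
    (P * Q * R).coeff m = ∑ᶠ x, assocTerm P Q R m x := by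
  rw [finsum_fiber₂ (β := ℤ × ℕ) (γ := ℤ × ℕ) (assocTerm P Q R m) (assocTerm_support P Q R m)
    (fun x => ((x.1 + x.2.1 - x.2.2.1, x.2.2.2.1 + x.2.2.2.2), (x.1, x.2.2.1)))
    (fun x => (x.2.2.2.1, x.2.2.2.2))
    (fun b _ => Finset.HasAntidiagonal.antidiagonal b.2)
    (fun b c w => (c.1, b.1 - c.1 + c.2, c.2, w.1, w.2)), coeff_mul]
  · refine finsum_congr fun ⟨k, i⟩ => ?_
    have h1 := mulTerm_support P Q k
    have h2 : (Function.support fun x => mulTerm P Q k x *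
        iterDeriv i (R.coeff (m - k + i))).Finite :=
      h1.subset fun x hx hx' => hx (by simp [hx'])
    simp only [mulTerm]
    rw [coeff_mul, finsum_mul' _ _ h1, smul_finsum' _ h2]
    refine finsum_congr fun ⟨p, j⟩ => ?_
    simp only [mulTerm, assocTerm]
    have hc : ∀ w ∈ Finset.HasAntidiagonal.antidiagonal i,
        (Ring.choose p (j + w.1) * ((j + w.1).choose j : ℤ) * Ring.choose (k - p + j) w.2) •
          (P.coeff p * iterDeriv j (Q.coeff (k - p + j)) *
            iterDeriv (w.1 + w.2) (R.coeff (m - p - (k - p + j) + j + w.1 + w.2))) =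
        (Ring.choose p j * (Ring.choose (p - j) w.1 * Ring.choose (k - p + j) w.2)) •
          (P.coeff p * iterDeriv j (Q.coeff (k - p + j)) *
            iterDeriv i (R.coeff (m - k + i))) := by
      intro w hw
      have hw' := Finset.HasAntidiagonal.mem_antidiagonal.mp hw
      have hch := Ring.choose_smul_choose p (Nat.le_add_right j w.1)
      rw [Nat.add_sub_cancel_left, nsmul_eq_mul] at hch
      rw [hw', mul_comm (Ring.choose p _), hch, mul_assoc,
        show m - p - (k - p + j) + j + w.1 + w.2 = m - k + i by omega]
    rw [Finset.sum_congr rfl hc, ← Finset.sum_smul, ← Finset.mul_sum,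
      ← Ring.add_choose_eq i (Commute.all _ _), smul_mul_assoc, smul_smul, mul_comm]
    congr 3
    ring
  · rintro ⟨p, q, j, v, t⟩
    simp [Finset.HasAntidiagonal.mem_antidiagonal]
  · rintro ⟨p, q, j, v, t⟩
    simp only [Prod.mk.injEq, and_true, true_and]
    ring
  · rintro ⟨k, i⟩ ⟨p, j⟩ ⟨v, t⟩ hw
    have hw' := Finset.HasAntidiagonal.mem_antidiagonal.mp hw
    simp only [Prod.mk.injEq, and_true]
    simp only at hw'
    exact ⟨by ring, hw'⟩
  · rintro ⟨k, i⟩ ⟨p, j⟩ ⟨v, t⟩ hw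
    rfl

theorem coeff_mul_mul_right (P Q R : PsDO) (m : ℤ) :
    (P * (Q * R)).coeff m = ∑ᶠ x, assocTerm P Q R m x := by
  rw [finsum_fiber₂ (β := ℤ × ℕ) (γ := ℤ × ℕ) (assocTerm P Q R m) (assocTerm_support P Q R m)
    (fun x => ((x.1, x.2.2.1 + x.2.2.2.1), (x.2.1, x.2.2.2.2)))
    (fun x => (x.2.2.1, x.2.2.2.1))
    (fun b _ => Finset.HasAntidiagonal.antidiagonal b.2)
    (fun b c w => (b.1, c.1, w.1, w.2, c.2)), coeff_mul]
  · refine finsum_congr fun ⟨p, s⟩ => ?_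
    simp only [mulTerm]
    have h1 := mulTerm_support Q R (m - p + s)
    have h2 : (Function.support fun x =>
        iterDeriv s (mulTerm Q R (m - p + s) x)).Finite :=
      h1.subset fun x hx hx' => hx (by simp [hx'])
    have h3 : (Function.support fun x => P.coeff p *
        iterDeriv s (mulTerm Q R (m - p + s) x)).Finite :=
      h2.subset fun x hx hx' => hx (by simp [hx'])
    have h4 : iterDeriv s (∑ᶠ x, mulTerm Q R (m - p + s) x) =
        ∑ᶠ x, iterDeriv s (mulTerm Q R (m - p + s) x) :=
      (iterDeriv s).toAddMonoidHom.map_finsum h1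
    rw [coeff_mul, h4, mul_finsum' _ _ h2, smul_finsum' _ h3]
    refine finsum_congr fun ⟨q, t⟩ => ?_
    simp only [mulTerm, assocTerm]
    rw [map_zsmul, iterDeriv_mul, mul_smul_comm, Finset.mul_sum, Finset.smul_sum,
      Finset.smul_sum]
    refine Finset.sum_congr rfl fun w hw => ?_
    have hw' := Finset.HasAntidiagonal.mem_antidiagonal.mp hw
    rw [← iterDeriv_add, hw', mul_smul_comm, ← natCast_zsmul, smul_smul, smul_smul, mul_assoc,
      show m - p + s - q + t = m - p - q + w.1 + w.2 + t by omega]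
    congr 1
    · ring
    · ring
  · rintro ⟨p, q, j, v, t⟩
    simp [Finset.HasAntidiagonal.mem_antidiagonal]
  · rintro ⟨p, q, j, v, t⟩
    rfl
  · rintro ⟨p, s⟩ ⟨q, t⟩ ⟨u, v⟩ hw
    have hw' := Finset.HasAntidiagonal.mem_antidiagonal.mp hw
    simp only [Prod.mk.injEq, and_true, true_and]
    exact hw'
  · rintro ⟨p, s⟩ ⟨q, t⟩ ⟨u, v⟩ hw
    rfl

instance : Ring PsDO :=
  { (inferInstance : AddCommGroup PsDO), (inferInstance : Mul PsDO),
    (inferInstance : One PsDO) with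
    zero_mul := fun P => by
      have h := add_mul' 0 0 P
      rwa [add_zero, left_eq_add] at h
    mul_zero := fun P => by
      have h := mul_add' P 0 0
      rwa [add_zero, left_eq_add] at h
    mul_assoc := fun P Q R => by
      ext1 m; rw [coeff_mul_mul_left, coeff_mul_mul_right]
    one_mul := one_mul'
    mul_one := mul_one'
    left_distrib := mul_add'
    right_distrib := add_mul' }

theorem coeff_sub (P Q : PsDO) (k : ℤ) : (P - Q).coeff k = P.coeff k - Q.coeff k := rfl

theorem coeff_sum {ι : Type*} (s : Finset ι) (P : ι → PsDO) (k : ℤ) :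
    (∑ l ∈ s, P l).coeff k = ∑ l ∈ s, (P l).coeff k :=
  map_sum (AddMonoidHom.mk' (fun P : PsDO => P.coeff k) fun P Q => coeff_add P Q k) P s

/-- The operator `∂ = d/dx`. -/
def partialX : PsDO :=
  mk (fun k => if k = 1 then 1 else 0) ⟨1, fun k hk => by simp [hk.ne']⟩

/-- The adjoint `P* = ∑_ℓ ∂^ℓ · a_ℓ(-x)` of `P = ∑_ℓ a_ℓ(x) ∂^ℓ`. Since
`∂^ℓ · b = ∑_i binom(ℓ, i) b^{(i)} ∂^{ℓ-i}`, its coefficient of `∂^m` is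
`∑_i binom(m+i, i) (d/dx)^i (a_{m+i}(-x))`. -/
def adjoint (P : PsDO) : PsDO :=
  mk (fun m => ∑ᶠ i : ℕ, Ring.choose (m + i) i • iterDeriv i (rescale (-1) (P.coeff (m + i)))) (by
    obtain ⟨N, hN⟩ := P.exists_bound
    refine ⟨N, fun m hm => ?_⟩
    rw [← finsum_zero (α := ℕ)]
    exact finsum_congr fun i => by simp [hN (m + i) (by omega)])

/-- The identification `f(z) ↦ f(∂⁻¹) ∂⁻¹`, `z^j ↦ ∂^{-j-1}`, as an operator with constant
coefficients. -/
def ofLaurent (f : LaurentSeries ℂ) : PsDO :=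
  mk (fun k => C (f.coeff (-k - 1))) (by
    obtain ⟨N, hN⟩ : ∃ N : ℤ, ∀ k < N, f.coeff k = 0 := by
      refine ⟨f.order, fun k hk => HahnSeries.coeff_eq_zero_of_lt_order hk⟩
    refine ⟨-N - 1 + 1, fun k hk => ?_⟩
    rw [hN _ (by omega), map_zero])

/-- The projection `ρ` of `PsDO` onto its quotient `ℂ((∂⁻¹))` by the left ideal generated by `x`,
followed by the identification `∂^{-j-1} ↦ z^j` with `ℂ((z))`. For `P = ∑_k a_k(x) ∂^k` the
coefficient of `∂^m` in `ρ(P)` is `∑_i (-1)^i binom(m+i, i) a_{m+i}^{(i)}(0)`. -/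
def rho (P : PsDO) : LaurentSeries ℂ :=
  HahnSeries.ofSuppBddBelow (fun j : ℤ => ∑ᶠ i : ℕ,
    ((-1 : ℂ) ^ i * (Ring.choose ((-j - 1) + i : ℤ) i : ℤ)) *
      constantCoeff (iterDeriv i (P.coeff ((-j - 1) + i)))) (by
    obtain ⟨N, hN⟩ := P.exists_bound
    refine ⟨-N - 1, fun j hj => ?_⟩
    by_contra hlt
    refine hj ?_
    rw [← finsum_zero (α := ℕ)]
    exact finsum_congr fun i => by simp [hN ((-j - 1) + i) (by omega)])

/-- The action of pseudo-differential operators on `ℂ((z))`: `P · f = ρ(P · f(∂⁻¹) ∂⁻¹)`. -/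
def act (P : PsDO) (f : LaurentSeries ℂ) : LaurentSeries ℂ := rho (P * ofLaurent f)

end PsDO

/-- Matrix pseudo-differential operators. -/
abbrev MatPsDO (n : ℕ) : Type := Matrix (Fin n) (Fin n) PsDO

namespace MatPsDO

variable {n : ℕ}

/-- `(P*)_{ij} = (P_{ji})*`. -/
def adjoint (P : MatPsDO n) : MatPsDO n := Matrix.of fun i j => (P j i).adjoint

/-- The action of matrix pseudo-differential operators on `ℂ((z))^n`. -/
def act (P : MatPsDO n) (f : Fin n → LaurentSeries ℂ) : Fin n → LaurentSeries ℂ :=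
  fun i => ∑ j, (P i j).act (f j)

/-- Monic operators of order zero: `I_n + gl_n(ℂ⟦x⟧)⟦∂⁻¹⟧ ∂⁻¹`. -/
def monicZero (n : ℕ) : Set (MatPsDO n) :=
  {S | ∀ i j, ∀ k : ℤ, 0 ≤ k → (S i j).coeff k = ((1 : MatPsDO n) i j).coeff k}

/-- All entries have order at most `d`. -/
def ordLE (d : ℤ) (P : MatPsDO n) : Prop := ∀ i j, ∀ k : ℤ, d < k → (P i j).coeff k = 0

theorem ordLE_mul {d e : ℤ} {P Q : MatPsDO n} (hP : ordLE d P) (hQ : ordLE e Q) :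
    ordLE (d + e) (P * Q) := by
  intro i j m hm
  rw [Matrix.mul_apply, PsDO.coeff_sum]
  exact Finset.sum_eq_zero fun l _ => PsDO.coeff_mul_eq_zero (hP i l) (hQ l j) m hm

theorem sub_one_mem {S : MatPsDO n} (hS : S ∈ monicZero n) :
    ordLE (-1) (1 - S) := by
  intro i j k hk
  have h := hS i j k (by omega)
  rw [Matrix.sub_apply, PsDO.coeff_sub, h, sub_self]

/-- Elements of `monicZero n` are invertible, by a geometric series. -/
theorem isUnit_of_mem_monicZero {S : MatPsDO n} (hS : S ∈ monicZero n) : IsUnit S := by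
  set N : MatPsDO n := 1 - S with hN
  have hN1 : ordLE (-1) N := sub_one_mem hS
  have hpow : ∀ k : ℕ, ordLE (-k) (N ^ k) := by
    intro k
    induction k with
    | zero =>
      intro i j m hm
      rw [pow_zero]
      by_cases h : i = j
      · subst h
        rw [Matrix.one_apply_eq, PsDO.coeff_one, if_neg (by push_cast at hm; omega)]
      · rw [Matrix.one_apply_ne h, PsDO.coeff_zero]
    | succ k ih =>
      rw [pow_succ]
      have h := ordLE_mul ih hN1
      intro i j m hm
      exact h i j m (by push_cast at hm ⊢; omega)
  set A : ℕ → MatPsDO n := fun K => ∑ k ∈ Finset.range (K + 1), N ^ k with hA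
  have hstab : ∀ (i j : Fin n) (m : ℤ) (K : ℕ), (-m).toNat ≤ K →
      (A K i j).coeff m = (A (-m).toNat i j).coeff m := by
    intro i j m K hK
    induction K, hK using Nat.le_induction with
    | base => rfl
    | succ K hK ih =>
      have h : A (K + 1) = A K + N ^ (K + 1) := Finset.sum_range_succ _ _
      rw [h, Matrix.add_apply, PsDO.coeff_add, ih, hpow (K + 1) i j m (by push_cast; omega),
        add_zero]
  let T : MatPsDO n := Matrix.of fun i j => PsDO.mk (fun m => (A (-m).toNat i j).coeff m)
    ⟨0, fun m hm => by
      have h : (-m).toNat = 0 := by omega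
      have h0 := hpow 0 i j m (by push_cast; omega)
      rw [h]
      simpa [hA] using h0⟩
  have hT : ∀ K : ℕ, ordLE (-(K + 1)) (T - A K) := by
    intro K i j m hm
    rw [Matrix.sub_apply, PsDO.coeff_sub, hstab i j m K (by omega)]
    exact sub_self _
  have hS0 : ordLE 0 S := by
    have h := hpow 0
    intro i j m hm
    have h0 := hpow 0 i j m (by push_cast; omega)
    rw [pow_zero] at h0
    rw [hS i j m hm.le, h0]
  have hSN : S = 1 - N := by rw [hN, sub_sub_cancel]
  have hz : ∀ X : MatPsDO n, (∀ K : ℕ, ordLE (-(K + 1)) X) → X = 0 := by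
    intro X hX
    refine Matrix.ext fun i j => PsDO.ext fun m => ?_
    exact hX (-m).toNat i j m (by omega)
  have hp : ∀ K : ℕ, ordLE (-(K + 1)) (N ^ (K + 1)) := fun K i j m hm =>
    hpow (K + 1) i j m (by push_cast; omega)
  have h1 : S * T - 1 = 0 := hz _ fun K => by
    have e : S * T - 1 = S * (T - A K) - N ^ (K + 1) := by
      have h : S * A K = 1 - N ^ (K + 1) := by rw [hSN]; exact mul_neg_geom_sum N (K + 1)
      rw [mul_sub, h]; abel
    rw [e]
    intro i j m hm
    rw [Matrix.sub_apply, PsDO.coeff_sub, hp K i j m hm,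
      ordLE_mul hS0 (hT K) i j m (by omega), sub_zero]
  have h2 : T * S - 1 = 0 := hz _ fun K => by
    have e : T * S - 1 = (T - A K) * S - N ^ (K + 1) := by
      have h : A K * S = 1 - N ^ (K + 1) := by rw [hSN]; exact geom_sum_mul_neg N (K + 1)
      rw [sub_mul, h]; abel
    rw [e]
    intro i j m hm
    rw [Matrix.sub_apply, PsDO.coeff_sub, hp K i j m hm,
      ordLE_mul (hT K) hS0 i j m (by omega), sub_zero]
  exact ⟨⟨S, T, sub_eq_zero.1 h1, sub_eq_zero.1 h2⟩, rfl⟩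

/-- The Lax operator `S · I_n ∂ · S⁻¹`. -/
def lax (S : MatPsDO n) : MatPsDO n :=
  S * Matrix.diagonal (fun _ => PsDO.partialX) * Ring.inverse S

end MatPsDO

namespace SatoGrassmannian

/-- `ℂ((z))^n`. -/
abbrev Ambient (n : ℕ) : Type := Fin n → LaurentSeries ℂ

/-- `ℂ⟦z⟧^n` inside `ℂ((z))^n`. -/
def nonneg (n : ℕ) : Submodule ℂ (Ambient n) where
  carrier := {f | ∀ i, ∀ k : ℤ, k < 0 → (f i).coeff k = 0}
  zero_mem' := fun _ _ _ => rfl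
  add_mem' := fun {f g} hf hg i k hk => by simp [hf i k hk, hg i k hk]
  smul_mem' := fun c f hf i k hk => by simp [hf i k hk]

/-- `ℂ[z⁻¹]^n · z⁻¹` inside `ℂ((z))^n`: a Laurent series has only finitely many terms of
negative degree. -/
def neg (n : ℕ) : Submodule ℂ (Ambient n) where
  carrier := {f | ∀ i, ∀ k : ℤ, 0 ≤ k → (f i).coeff k = 0}
  zero_mem' := fun _ _ _ => rfl
  add_mem' := fun {f g} hf hg i k hk => by simp [hf i k hk, hg i k hk]
  smul_mem' := fun c f hf i k hk => by simp [hf i k hk]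

variable {n : ℕ}

/-- The natural map `γ_W : W → ℂ((z))^n / ℂ⟦z⟧^n`. -/
def gamma (W : Submodule ℂ (Ambient n)) : W →ₗ[ℂ] Ambient n ⧸ nonneg n :=
  (nonneg n).mkQ ∘ₗ W.subtype

/-- `Gr_n(ℂ)`: subspaces `W` for which `γ_W` is Fredholm. -/
def Gr (n : ℕ) : Set (Submodule ℂ (Ambient n)) :=
  {W | Module.Finite ℂ (LinearMap.ker (gamma W)) ∧
    Module.Finite ℂ ((Ambient n ⧸ nonneg n) ⧸ LinearMap.range (gamma W))}

/-- The big cell: points of `Gr_n(ℂ)` for which `γ_W` is an isomorphism (in particular of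
index zero). -/
def bigCell (n : ℕ) : Set (Submodule ℂ (Ambient n)) :=
  {W | W ∈ Gr n ∧ Function.Bijective (gamma W)}

theorem smul_mul_laurent (c : ℂ) (f g : LaurentSeries ℂ) : (c • f) * g = c • (f * g) := by
  rw [← HahnSeries.C_mul_eq_smul, mul_assoc, HahnSeries.C_mul_eq_smul]

/-- The pairing `⟨f, g⟩_n`: the coefficient of `z⁻¹` in `∑_i f_i g_i`. -/
def pairing (f g : Ambient n) : ℂ := ∑ i, (f i * g i).coeff (-1)

/-- The orthogonal complement `W^⊥`. -/
def perp (W : Submodule ℂ (Ambient n)) : Submodule ℂ (Ambient n) where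
  carrier := {f | ∀ w ∈ W, pairing f w = 0}
  zero_mem' := fun w _ => by simp [pairing]
  add_mem' := fun {f g} hf hg w hw => by
    have h1 := hf w hw
    have h2 := hg w hw
    simp only [pairing] at h1 h2 ⊢
    simp [add_mul, Finset.sum_add_distrib, h1, h2]
  smul_mem' := fun c f hf w hw => by
    have h1 := hf w hw
    simp only [pairing] at h1 ⊢
    simp only [Pi.smul_apply, smul_mul_laurent, HahnSeries.coeff_smul]
    rw [← Finset.smul_sum, h1, smul_zero]

/-- `Γ_n`: invertible diagonal matrices over `ℂ⟦z⟧` whose constant term is a scalar matrix. -/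
def Gam (n : ℕ) : Subgroup (Fin n → ℂ⟦X⟧ˣ) where
  carrier := {γ | ∃ c : ℂˣ, ∀ i, constantCoeff (γ i : ℂ⟦X⟧) = c}
  one_mem' := ⟨1, fun i => by simp⟩
  mul_mem' := by
    rintro a b ⟨c, hc⟩ ⟨d, hd⟩
    exact ⟨c * d, fun i => by simp [hc i, hd i]⟩
  inv_mem' := by
    rintro a ⟨c, hc⟩
    refine ⟨c⁻¹, fun i => ?_⟩
    have h : constantCoeff (a i : ℂ⟦X⟧) * constantCoeff ((a i)⁻¹ : ℂ⟦X⟧ˣ).val = 1 := by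
      rw [← map_mul, Units.mul_inv, map_one]
    rw [hc i] at h
    simpa using eq_inv_of_mul_eq_one_right h

/-- The action of a diagonal matrix over `ℂ⟦z⟧` on `ℂ((z))^n`. -/
def diag (γ : Fin n → ℂ⟦X⟧ˣ) : Ambient n →ₗ[ℂ] Ambient n where
  toFun f i := HahnSeries.ofPowerSeries ℤ ℂ (γ i : ℂ⟦X⟧) * f i
  map_add' f g := by funext i; simp [mul_add]
  map_smul' c f := by
    funext i
    simp only [Pi.smul_apply, RingHom.id_apply]
    rw [mul_comm, smul_mul_laurent, mul_comm]

theorem diag_one : diag (1 : Fin n → ℂ⟦X⟧ˣ) = LinearMap.id := by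
  refine LinearMap.ext fun f => funext fun i => ?_
  simp [diag]

theorem diag_mul (γ δ : Fin n → ℂ⟦X⟧ˣ) : diag (γ * δ) = diag γ ∘ₗ diag δ := by
  refine LinearMap.ext fun f => funext fun i => ?_
  simp [diag, mul_assoc]

/-- Two subspaces are equivalent when they lie in the same `Γ_n`-orbit. -/
def orbitSetoid (n : ℕ) : Setoid (Submodule ℂ (Ambient n)) where
  r W W' := ∃ γ ∈ Gam n, W' = W.map (diag γ)
  iseqv :=
    { refl := fun W => ⟨1, one_mem _, by rw [diag_one, Submodule.map_id]⟩
      symm := by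
        rintro W _ ⟨γ, hγ, rfl⟩
        refine ⟨γ⁻¹, inv_mem hγ, ?_⟩
        rw [← Submodule.map_comp, ← diag_mul, inv_mul_cancel, diag_one, Submodule.map_id]
      trans := by
        rintro W _ _ ⟨γ, hγ, rfl⟩ ⟨δ, hδ, rfl⟩
        exact ⟨δ * γ, mul_mem hδ hγ, by rw [diag_mul, Submodule.map_comp]⟩ }

theorem pairing_diag (γ : Fin n → ℂ⟦X⟧ˣ) (f g : Ambient n) :
    pairing (diag γ f) g = pairing f (diag γ g) := by
  simp only [pairing, diag, LinearMap.coe_mk, AddHom.coe_mk]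
  exact Finset.sum_congr rfl fun i _ => by rw [mul_right_comm, mul_comm]

theorem perp_map_diag (γ : Fin n → ℂ⟦X⟧ˣ) (W : Submodule ℂ (Ambient n)) :
    perp (W.map (diag γ)) = (perp W).map (diag γ⁻¹) := by
  ext f
  constructor
  · intro hf
    refine ⟨diag γ f, fun w hw => ?_, ?_⟩
    · rw [pairing_diag]; exact hf _ (Submodule.mem_map_of_mem hw)
    · rw [← LinearMap.comp_apply, ← diag_mul, inv_mul_cancel, diag_one, LinearMap.id_apply]
  · rintro ⟨g, hg, rfl⟩ _ ⟨w, hw, rfl⟩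
    rw [pairing_diag, ← LinearMap.comp_apply, ← diag_mul, inv_mul_cancel, diag_one,
      LinearMap.id_apply]
    exact hg w hw

/-- The set of `Γ_n`-orbits of subspaces; `Z_n = Gr_n / Γ_n` is the part of it that consists of
the orbits of points of `Gr_n`. -/
abbrev OrbitSpace (n : ℕ) : Type := Quotient (orbitSetoid n)

/-- The class `W̄` of a subspace `W`. -/
def orbit (W : Submodule ℂ (Ambient n)) : OrbitSpace n := Quotient.mk (orbitSetoid n) W

/-- The big cell of `Z_n(ℂ)`. -/
def bigCellZ (n : ℕ) : Set (OrbitSpace n) := orbit '' bigCell n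

/-- `W̄^⊥` is the class of `W^⊥`. -/
def perpZ : OrbitSpace n → OrbitSpace n :=
  Quotient.map (sa := orbitSetoid n) (sb := orbitSetoid n) perp (by
    rintro W _ ⟨γ, hγ, rfl⟩
    exact ⟨γ⁻¹, inv_mem hγ, perp_map_diag γ W⟩)

/-- `W` corresponds to the monic operator `S` of order zero: `W = S⁻¹ · ℂ[z⁻¹]^n z⁻¹`.
All elements of `monicZero n` are units, so `Ring.inverse S` is the inverse of `S`. -/
def Corresponds (W : Submodule ℂ (Ambient n)) (S : MatPsDO n) : Prop :=
  S ∈ MatPsDO.monicZero n ∧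
    (W : Set (Ambient n)) = MatPsDO.act (Ring.inverse S) '' (neg n : Set (Ambient n))

/-- The point `w` of `Z_n` corresponds to `L`: it is the class of a point `W` of the big cell
that corresponds to some `S`, and `L = S · I_n ∂ · S⁻¹`. -/
def LaxCorresponds (w : OrbitSpace n) (L : MatPsDO n) : Prop :=
  ∃ W ∈ bigCell n, ∃ S, Corresponds W S ∧ w = orbit W ∧ L = MatPsDO.lax S

end SatoGrassmannian

end

noncomputable section

/-! Everything rests on two properties of the adjoint on `PsDO`: it is an anti-automorphism, and it
is the transpose for the residue pairing.

Since `x* = -x` and `∂* = ∂`, the adjoint is determined by its effect on monomials. Vandermonde's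
identity gives `(X ∂^l)* = ∂^l X*`, Leibniz' rule gives `(a X)* = X* a(-x)`, and an alternating
binomial sum gives `P** = P`. The general `adjoint_mul` follows by peeling off leading terms,
because each coefficient involves only finitely many of them.

If `P = ∑ ∂^l b_l`, its class modulo the left ideal of `x` is `∑ b_l(0) ∂^l`, and this is `P*` with
left coefficients taken at `x = 0` (`ofLaurent_rho`). So `P` acts on `f` as right multiplication by
`P*` followed by evaluation at `0`. The pairing of `P f` with `g` is then the residue at `x = 0` of
`f P* g`; the adjoint preserves this residue and reverses the product, so `P` and `P*` are
transposes (`coeff_neg_one_act_mul`).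

Let `H = ℂ[z⁻¹]^n z⁻¹`, which is its own orthogonal complement (`perp_neg`). For `W = S⁻¹ H`,
transposition gives `W^⊥ = S* H`, the point attached to `(S*)⁻¹`. Monic operators of order zero and
their inverses preserve `ℂ⟦z⟧^n`, so any such translate of `H` is again a complement of `ℂ⟦z⟧^n`,
hence in the big cell. Finally `(S ∂ S⁻¹)* = (S*)⁻¹ ∂ S*` gives the Lax statement. -/

/-- A finitely supported double sum over `ℕ × ℕ`, regrouped along antidiagonals. -/
theorem finsum_finsum_eq_finsum_antidiagonal {M : Type*} [AddCommMonoid M] (f : ℕ → ℕ → M)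
    (hf : (Function.support fun x : ℕ × ℕ => f x.1 x.2).Finite) :
    ∑ᶠ (i) (j), f i j =
      ∑ᶠ s, ∑ x ∈ Finset.HasAntidiagonal.antidiagonal s, f x.1 x.2 := by
  rw [finsum_fiber (fun x : ℕ × ℕ => f x.1 x.2) hf (fun x => x.1 + x.2) _
    (fun a b => Finset.HasAntidiagonal.mem_antidiagonal), finsum_curry _ hf]

theorem iterDeriv_rescale_neg_one (i : ℕ) (a : ℂ⟦X⟧) :
    iterDeriv i (rescale (-1) a) = (-1 : ℤ) ^ i • rescale (-1) (iterDeriv i a) := by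
  induction i with
  | zero => simp [iterDeriv_zero]
  | succ i ih =>
    have h1 : ∀ c : ℂ⟦X⟧, iterDeriv 1 c = (d⁄dX ℂ) c := fun c => rfl
    have h2 : ∀ c : ℂ⟦X⟧, (d⁄dX ℂ) (rescale (-1) c) = -rescale (-1) ((d⁄dX ℂ) c) := by
      intro c
      ext k
      simp [coeff_derivative, coeff_rescale, pow_succ, mul_assoc]
    rw [add_comm i 1, iterDeriv_add, ih, map_zsmul, h1, h2, iterDeriv_add, h1, pow_add]
    simp

theorem rescale_neg_one_rescale_neg_one (a : ℂ⟦X⟧) : rescale (-1) (rescale (-1) a) = a := by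
  simp [rescale_rescale]

/-! ### The adjoint as an anti-involution of the scalar operators. -/

namespace PsDO

theorem adjoint_support (P : PsDO) (m : ℤ) :
    (Function.support fun i : ℕ =>
      Ring.choose (m + i) i • iterDeriv i (rescale (-1) (P.coeff (m + i)))).Finite := by
  obtain ⟨N, hN⟩ := P.exists_bound
  refine (Set.finite_Iic (N - m).toNat).subset fun i hi => ?_
  have h : m + i ≤ N := by
    by_contra h; exact hi (by simp [hN _ (not_le.1 h)])
  simp only [Set.mem_Iic]
  omega

theorem coeff_adjoint (P : PsDO) (m : ℤ) : P.adjoint.coeff m =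
    ∑ᶠ i : ℕ, Ring.choose (m + i) i • iterDeriv i (rescale (-1) (P.coeff (m + i))) := rfl

theorem adjoint_add (P Q : PsDO) : (P + Q).adjoint = P.adjoint + Q.adjoint := by
  ext1 m
  rw [coeff_add, coeff_adjoint, coeff_adjoint, coeff_adjoint,
    ← finsum_add_distrib (adjoint_support P m) (adjoint_support Q m)]
  exact finsum_congr fun i => by simp

theorem coeff_adjoint_eq_zero {P : PsDO} {N : ℤ} (hN : ∀ k, N < k → P.coeff k = 0) (m : ℤ)
    (hm : N < m) : P.adjoint.coeff m = 0 := by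
  rw [coeff_adjoint, ← finsum_zero (α := ℕ)]
  exact finsum_congr fun i => by simp [hN (m + i) (by omega)]

/-- Finite support of families indexed by `ℕ × ℕ` built from the coefficients of an operator. -/
theorem finite_support_of_coeff (P : PsDO) (m : ℤ) (f : ℕ × ℕ → ℂ⟦X⟧)
    (hf : ∀ x, P.coeff (m + x.1 + x.2) = 0 → f x = 0) : (Function.support f).Finite := by
  obtain ⟨N, hN⟩ := P.exists_bound
  have h := Set.finite_Iic (N - m).toNat
  refine (h.prod h).subset fun x hx => ?_
  have h1 : m + x.1 + x.2 ≤ N := by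
    by_contra h; exact hx (hf x (hN _ (not_le.1 h)))
  simp only [Set.mem_prod, Set.mem_Iic]
  omega

/-- The operator `a ∂^k`. -/
def monomial (a : ℂ⟦X⟧) (k : ℤ) : PsDO :=
  mk (fun m => if m = k then a else 0) ⟨k, fun m hm => by simp [hm.ne']⟩

theorem coeff_monomial (a : ℂ⟦X⟧) (k m : ℤ) :
    (monomial a k).coeff m = if m = k then a else 0 := rfl

theorem partialX_eq_monomial : partialX = monomial 1 1 := rfl

theorem coeff_monomial_mul (a : ℂ⟦X⟧) (k : ℤ) (Q : PsDO) (m : ℤ) :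
    (monomial a k * Q).coeff m =
      ∑ᶠ i : ℕ, Ring.choose k i • (a * iterDeriv i (Q.coeff (m - k + i))) := by
  rw [coeff_mul, finsum_curry _ (mulTerm_support _ _ _), finsum_eq_single _ k]
  · exact finsum_congr fun i => by simp [mulTerm, coeff_monomial]
  · intro l hl
    rw [← finsum_zero (α := ℕ)]
    exact finsum_congr fun i => by simp [mulTerm, coeff_monomial, hl]

theorem coeff_mul_monomial (Q : PsDO) (a : ℂ⟦X⟧) (k : ℤ) (m : ℤ) :
    (Q * monomial a k).coeff m =
      ∑ᶠ i : ℕ, Ring.choose (m - k + i) i • (Q.coeff (m - k + i) * iterDeriv i a) := by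
  have h : (Function.support fun x : ℕ × ℤ => mulTerm Q (monomial a k) m (x.2, x.1)).Finite :=
    (mulTerm_support Q (monomial a k) m).preimage (f := Prod.swap)
      (Prod.swap_injective.injOn)
  rw [coeff_mul, ← finsum_comp_equiv (Equiv.prodComm ℕ ℤ)]
  refine (finsum_curry _ h).trans (finsum_congr fun i => ?_)
  rw [finsum_eq_single _ (m - k + i)]
  · simp only [mulTerm, coeff_monomial]
    rw [if_pos (by omega)]
  · intro l hl
    simp only [mulTerm, coeff_monomial]
    rw [if_neg (by omega)]
    simp

theorem coeff_mul_monomial_one (Q : PsDO) (k m : ℤ) :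
    (Q * monomial 1 k).coeff m = Q.coeff (m - k) := by
  rw [coeff_mul_monomial, finsum_eq_single _ 0]
  · simp [iterDeriv_zero]
  · intro i hi
    simp [iterDeriv_one i hi]

theorem coeff_monomial_zero_mul (a : ℂ⟦X⟧) (Q : PsDO) (m : ℤ) :
    (monomial a 0 * Q).coeff m = a * Q.coeff m := by
  rw [coeff_monomial_mul, finsum_eq_single _ 0]
  · simp [iterDeriv_zero]
  · intro i hi
    simp [Ring.choose_zero_pos ℤ (Nat.pos_of_ne_zero hi)]

theorem monomial_eq_mul (a : ℂ⟦X⟧) (k : ℤ) : monomial a k = monomial a 0 * monomial 1 k := by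
  ext1 m
  rw [coeff_monomial_zero_mul, coeff_monomial, coeff_monomial]
  simp

/-- `(X ∂^l)* = ∂^l X*`. -/
theorem adjoint_mul_monomial_one (P : PsDO) (l : ℤ) :
    (P * monomial 1 l).adjoint = monomial 1 l * P.adjoint := by
  ext1 m
  rw [coeff_monomial_mul, coeff_adjoint]
  have h1 : ∀ i : ℕ, Ring.choose l i • (1 * iterDeriv i (P.adjoint.coeff (m - l + i))) =
      ∑ᶠ j : ℕ, (Ring.choose l i * Ring.choose (m - l + i + j) j) •
        iterDeriv (i + j) (rescale (-1) (P.coeff (m - l + i + j))) := by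
    intro i
    have hs := adjoint_support P (m - l + i)
    rw [one_mul, coeff_adjoint]
    have h := (iterDeriv i).toAddMonoidHom.map_finsum hs
    simp only [LinearMap.toAddMonoidHom_coe] at h
    rw [h, smul_finsum' _ (hs.subset fun x hx hx' => hx (by simp [hx']))]
    exact finsum_congr fun j => by rw [map_zsmul, smul_smul, iterDeriv_add]
  rw [finsum_congr h1, finsum_finsum_eq_finsum_antidiagonal]
  · refine finsum_congr fun s => ?_
    rw [coeff_mul_monomial_one]
    have h2 : ∀ w ∈ Finset.HasAntidiagonal.antidiagonal s,
        (Ring.choose l w.1 * Ring.choose (m - l + w.1 + w.2) w.2) •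
          iterDeriv (w.1 + w.2) (rescale (-1) (P.coeff (m - l + w.1 + w.2))) =
        (Ring.choose l w.1 * Ring.choose (m + s - l) w.2) •
          iterDeriv s (rescale (-1) (P.coeff (m + s - l))) := by
      intro w hw
      have hw' := Finset.HasAntidiagonal.mem_antidiagonal.mp hw
      rw [hw', show m - l + w.1 + w.2 = m + s - l by omega]
    -- Vandermonde: the upper indices `l` and `m + s - l` add up to `m + s`, the one in the
    -- definition of the adjoint.
    rw [Finset.sum_congr rfl h2, ← Finset.sum_smul, ← Ring.add_choose_eq s (Commute.all _ _),
      add_sub_cancel]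
  · exact finite_support_of_coeff P (m - l) _ fun x hx => by simp [hx]

/-- `(a X)* = X* a(-x)`. -/
theorem adjoint_monomial_zero_mul (a : ℂ⟦X⟧) (P : PsDO) :
    (monomial a 0 * P).adjoint = P.adjoint * monomial (rescale (-1) a) 0 := by
  ext1 m
  rw [coeff_mul_monomial, coeff_adjoint]
  have h1 : ∀ i : ℕ, Ring.choose (m - 0 + i) i •
        (P.adjoint.coeff (m - 0 + i) * iterDeriv i (rescale (-1) a)) =
      ∑ᶠ j : ℕ, (Ring.choose (m + i) i * Ring.choose (m + i + j) j) •
        (iterDeriv j (rescale (-1) (P.coeff (m + i + j))) * iterDeriv i (rescale (-1) a)) := by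
    intro i
    rw [sub_zero]
    have hs := adjoint_support P (m + i)
    rw [coeff_adjoint, finsum_mul' _ _ hs,
      smul_finsum' _ (hs.subset fun x hx hx' => hx (by simp [hx']))]
    exact finsum_congr fun j => by rw [smul_mul_assoc, smul_smul]
  rw [finsum_congr h1, finsum_finsum_eq_finsum_antidiagonal]
  · refine finsum_congr fun s => ?_
    rw [coeff_monomial_zero_mul, map_mul, iterDeriv_mul, Finset.smul_sum]
    refine Finset.sum_congr rfl fun w hw => ?_
    have hw' := Finset.HasAntidiagonal.mem_antidiagonal.mp hw
    -- With `w = (i, j)`, `i + j = s`: binom(m+s, s) binom(s, j) = binom(m+s, j) binom(m+i, i),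
    -- which turns the Leibniz weights into those of the iterated sum.
    have hch := Ring.choose_smul_choose (m + s) (show w.2 ≤ s by omega)
    rw [nsmul_eq_mul, show s - w.2 = w.1 by omega,
      show m + (s : ℤ) - (w.2 : ℤ) = m + w.1 by omega] at hch
    rw [show m + w.1 + w.2 = m + s by omega, mul_comm (Ring.choose (m + (w.1 : ℤ)) w.1), ← hch,
      mul_comm (iterDeriv w.2 _), ← natCast_zsmul, smul_smul, mul_comm (Ring.choose (m + (s : ℤ)) s),
      Nat.choose_symm_of_eq_add hw'.symm]
  · exact finite_support_of_coeff P m _ fun x hx => by simp [hx]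

/-- The adjoint is an involution. -/
theorem adjoint_adjoint (P : PsDO) : P.adjoint.adjoint = P := by
  ext1 m
  rw [coeff_adjoint]
  have h1 : ∀ i : ℕ, Ring.choose (m + i) i •
        iterDeriv i (rescale (-1) (P.adjoint.coeff (m + i))) =
      ∑ᶠ j : ℕ, (Ring.choose (m + i) i * Ring.choose (m + i + j) j * (-1) ^ j) •
        iterDeriv (i + j) (P.coeff (m + i + j)) := by
    intro i
    have hs := adjoint_support P (m + i)
    have h := ((iterDeriv i).toAddMonoidHom.comp
      (rescale (-1 : ℂ)).toAddMonoidHom).map_finsum hs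
    rw [coeff_adjoint]
    refine Eq.trans (congrArg _ h) ?_
    rw [smul_finsum' _ (hs.subset fun x hx hx' => hx (by simp only [hx', map_zero]))]
    refine finsum_congr fun j => ?_
    simp only [AddMonoidHom.coe_comp, Function.comp_apply, LinearMap.toAddMonoidHom_coe,
      RingHom.toAddMonoidHom_eq_coe, AddMonoidHom.coe_coe]
    rw [map_zsmul, map_zsmul, iterDeriv_rescale_neg_one j, map_zsmul,
      rescale_neg_one_rescale_neg_one, map_zsmul, smul_smul, smul_smul, iterDeriv_add, mul_assoc]
  rw [finsum_congr h1, finsum_finsum_eq_finsum_antidiagonal, finsum_eq_single _ 0]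
  · simp [iterDeriv_zero]
  · intro s hs
    have h2 : ∀ w ∈ Finset.HasAntidiagonal.antidiagonal s,
        (Ring.choose (m + w.1) w.1 * Ring.choose (m + w.1 + w.2) w.2 * (-1 : ℤ) ^ w.2) •
          iterDeriv (w.1 + w.2) (P.coeff (m + w.1 + w.2)) =
        (Ring.choose (m + s) s * ((-1 : ℤ) ^ w.2 * s.choose w.2)) •
          iterDeriv s (P.coeff (m + s)) := by
      intro w hw
      have hw' := Finset.HasAntidiagonal.mem_antidiagonal.mp hw
      have hch := Ring.choose_smul_choose (m + s) (show w.2 ≤ s by omega)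
      rw [nsmul_eq_mul, show s - w.2 = w.1 by omega,
        show m + (s : ℤ) - (w.2 : ℤ) = m + w.1 by omega] at hch
      rw [hw', show m + w.1 + w.2 = m + s by omega, mul_comm (Ring.choose (m + (w.1 : ℤ)) w.1),
        ← hch]
      congr 1
      ring
    rw [Finset.sum_congr rfl h2, ← Finset.sum_smul, ← Finset.mul_sum,
      Finset.Nat.sum_antidiagonal_eq_sum_range_succ_mk, ← Finset.sum_range_reflect]
    -- The total weight of the `s`-th derivative is binom(m+s, s) times the alternating sum of
    -- binom(s, j), so only `s = 0` survives.
    have h3 := Int.alternating_sum_range_choose_of_ne hs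
    have h4 : ∑ j ∈ Finset.range (s + 1), ((-1 : ℤ) ^ (s - (s + 1 - 1 - j)) *
        (s.choose (s - (s + 1 - 1 - j)) : ℤ)) = 0 := by
      rw [← h3]
      refine Finset.sum_congr rfl fun j hj => ?_
      rw [show s - (s + 1 - 1 - j) = j by have := Finset.mem_range.1 hj; omega]
    simp only [Nat.succ_eq_add_one]
    rw [h4, mul_zero, zero_smul]
  · exact finite_support_of_coeff P m _ fun x hx => by simp [hx]

/-- `(∂^k X)* = X* ∂^k`. -/
theorem adjoint_monomial_one_mul (k : ℤ) (P : PsDO) :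
    (monomial 1 k * P).adjoint = P.adjoint * monomial 1 k := by
  -- Involutivity converts the rule for right multiplication by a power of `∂`, applied to `P*`,
  -- into the rule for left multiplication.
  rw [← adjoint_adjoint (P.adjoint * monomial 1 k), adjoint_mul_monomial_one, adjoint_adjoint]

theorem adjoint_one : (1 : PsDO).adjoint = 1 := by
  ext1 m
  rw [coeff_adjoint, finsum_eq_single _ 0]
  · simp only [coeff_one]
    split_ifs <;> simp_all [iterDeriv_zero]
  · intro i hi
    simp only [coeff_one]
    split_ifs
    · rw [map_one, iterDeriv_one i hi, smul_zero]
    · simp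

theorem adjoint_monomial (a : ℂ⟦X⟧) (k : ℤ) :
    (monomial a k).adjoint = monomial 1 k * monomial (rescale (-1) a) 0 := by
  have h := adjoint_mul_monomial_one 1 k
  rw [one_mul, adjoint_one, mul_one] at h
  rw [monomial_eq_mul, adjoint_monomial_zero_mul, h]

/-- Factor `a ∂^k` as `a` times `∂^k` and apply the two one-sided rules in turn. This is the
inductive step for general products. -/
theorem adjoint_monomial_mul (a : ℂ⟦X⟧) (k : ℤ) (Q : PsDO) :
    (monomial a k * Q).adjoint = Q.adjoint * (monomial a k).adjoint := by
  rw [adjoint_monomial, monomial_eq_mul, mul_assoc, adjoint_monomial_zero_mul,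
    adjoint_monomial_one_mul, mul_assoc]

/-- The adjoint is an anti-homomorphism. -/
theorem adjoint_mul (P Q : PsDO) : (P * Q).adjoint = Q.adjoint * P.adjoint := by
  ext1 m
  obtain ⟨N, hN⟩ := P.exists_bound
  obtain ⟨M, hM⟩ := Q.exists_bound
  -- Only terms of `P` of order at least `m - M` can reach the coefficient of `∂^m`, where `M`
  -- bounds the order of `Q`. The number `d` counts the remaining ones; at `d = 0` both products
  -- have order at most `m - 1`.
  have key : ∀ (d : ℕ) (P : PsDO), (∀ k, m - M - 1 + d < k → P.coeff k = 0) →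
      (P * Q).adjoint.coeff m = (Q.adjoint * P.adjoint).coeff m := by
    intro d
    induction d with
    | zero =>
      intro P hP
      rw [coeff_adjoint_eq_zero (coeff_mul_eq_zero hP hM) m (by omega),
        coeff_mul_eq_zero (coeff_adjoint_eq_zero hM) (coeff_adjoint_eq_zero hP) m (by omega)]
    | succ d ih =>
      intro P hP
      set k : ℤ := m - M - 1 + (d + 1 : ℕ) with hk
      -- Removing the term at the top admissible order `k` lowers the bound by one.
      have h := ih (P - monomial (P.coeff k) k) fun l hl => by
        rw [coeff_sub, coeff_monomial]
        split_ifs with hlk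
        · rw [hlk, sub_self]
        · rw [hP l (by omega), sub_zero]
      have e : P = monomial (P.coeff k) k + (P - monomial (P.coeff k) k) := by abel
      rw [e, add_mul, adjoint_add, adjoint_add, mul_add, coeff_add, coeff_add, h,
        adjoint_monomial_mul]
  exact key (N - (m - M - 1)).toNat P fun k hk => hN k (by omega)

end PsDO

/-! ### The action on Laurent series and the residue pairing. -/

/-- The coefficients of a product of Laurent series, as a convolution. -/
theorem LaurentSeries.coeff_mul_eq_finsum (f g : LaurentSeries ℂ) (m : ℤ) :
    (f * g).coeff m = ∑ᶠ j : ℤ, f.coeff j * g.coeff (m - j) := by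
  rw [HahnSeries.coeff_mul, finsum_eq_sum_of_support_subset
    (s := (Finset.antidiagonal f.isPWO_support g.isPWO_support m).image Prod.fst),
    Finset.sum_image]
  · refine Finset.sum_congr rfl fun x hx => ?_
    rw [Finset.mem_antidiagonal] at hx
    rw [← hx.2.2, add_sub_cancel_left]
  · intro x hx y hy h
    rw [Finset.mem_coe, Finset.mem_antidiagonal] at hx hy
    exact Prod.ext h (by omega)
  · intro j hj
    simp only [Finset.coe_image, Set.mem_image, Finset.mem_coe, Finset.mem_antidiagonal]
    exact ⟨(j, m - j), ⟨left_ne_zero_of_mul hj, right_ne_zero_of_mul hj, add_sub_cancel j m⟩, rfl⟩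

theorem iterDeriv_C (i : ℕ) (hi : i ≠ 0) (c : ℂ) : iterDeriv i (C c) = 0 := by
  have h : (C c : ℂ⟦X⟧) = c • 1 := by rw [smul_eq_C_mul, mul_one]
  rw [h, map_smul, iterDeriv_one i hi, smul_zero]

theorem rescale_C (c d : ℂ) : rescale c (C d) = C d := by
  ext k
  rw [coeff_rescale, coeff_C]
  split_ifs with h
  · simp [h]
  · simp

theorem constantCoeff_rescale_neg_one (a : ℂ⟦X⟧) :
    constantCoeff (rescale (-1) a) = constantCoeff a := by
  rw [← coeff_zero_eq_constantCoeff_apply, coeff_rescale, pow_zero, one_mul,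
    coeff_zero_eq_constantCoeff_apply]

namespace PsDO

/-- The operator obtained by evaluating the (left) coefficients at `x = 0`. -/
def evalZero (P : PsDO) : PsDO :=
  mk (fun k => C (constantCoeff (P.coeff k))) (by
    obtain ⟨N, hN⟩ := P.exists_bound
    exact ⟨N, fun k hk => by simp [hN k hk]⟩)

theorem coeff_evalZero (P : PsDO) (k : ℤ) :
    P.evalZero.coeff k = C (constantCoeff (P.coeff k)) := rfl

theorem evalZero_add (P Q : PsDO) : (P + Q).evalZero = P.evalZero + Q.evalZero := by
  ext1 k
  simp [coeff_evalZero]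

theorem constantCoeff_coeff_mul (P Q : PsDO) (m : ℤ) :
    constantCoeff ((P * Q).coeff m) = ∑ᶠ x : ℤ × ℕ, Ring.choose x.1 x.2 •
      (constantCoeff (P.coeff x.1) * constantCoeff (iterDeriv x.2 (Q.coeff (m - x.1 + x.2)))) := by
  have h := (constantCoeff (R := ℂ)).toAddMonoidHom.map_finsum (mulTerm_support P Q m)
  refine h.trans (finsum_congr fun x => ?_)
  simp only [RingHom.toAddMonoidHom_eq_coe, AddMonoidHom.coe_coe, mulTerm]
  rw [map_zsmul, map_mul]

/-- Differentiation in a product hits only the coefficients of the right factor, so those of the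
left factor enter through their values at `0`. Equivalently, the kernel of evaluation is the right
ideal `x · PsDO`. -/
theorem evalZero_evalZero_mul (P Q : PsDO) : (P.evalZero * Q).evalZero = (P * Q).evalZero := by
  ext1 m
  rw [coeff_evalZero, coeff_evalZero, constantCoeff_coeff_mul, constantCoeff_coeff_mul]
  simp only [coeff_evalZero, constantCoeff_C]

theorem coeff_ofLaurent (f : LaurentSeries ℂ) (k : ℤ) :
    (ofLaurent f).coeff k = C (f.coeff (-k - 1)) := rfl

theorem ofLaurent_add (f g : LaurentSeries ℂ) :
    ofLaurent (f + g) = ofLaurent f + ofLaurent g := by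
  ext1 k
  simp [coeff_ofLaurent]

theorem ofLaurent_injective : Function.Injective ofLaurent := by
  intro f g h
  ext j
  have h1 := congrArg (fun P => constantCoeff (PsDO.coeff P (-j - 1))) h
  simpa [coeff_ofLaurent] using h1

theorem evalZero_ofLaurent (f : LaurentSeries ℂ) : (ofLaurent f).evalZero = ofLaurent f := by
  ext1 k
  rw [coeff_evalZero, coeff_ofLaurent, constantCoeff_C]

theorem adjoint_ofLaurent (f : LaurentSeries ℂ) : (ofLaurent f).adjoint = ofLaurent f := by
  ext1 m
  rw [coeff_adjoint, finsum_eq_single _ 0]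
  · simp [iterDeriv_zero, coeff_ofLaurent, rescale_C]
  · intro i hi
    rw [coeff_ofLaurent, rescale_C, iterDeriv_C i hi, smul_zero]

/-- The projection to `ℂ((∂⁻¹))` takes the right coefficients at `x = 0`. -/
theorem ofLaurent_rho (P : PsDO) : ofLaurent (rho P) = P.adjoint.evalZero := by
  ext1 m
  rw [coeff_ofLaurent, coeff_evalZero, coeff_adjoint]
  have h := (constantCoeff (R := ℂ)).toAddMonoidHom.map_finsum (adjoint_support P m)
  refine congrArg C (Eq.trans ?_ h.symm)
  rw [rho, HahnSeries.coeff_ofSuppBddBelow]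
  refine finsum_congr fun i => ?_
  simp only [RingHom.toAddMonoidHom_eq_coe, AddMonoidHom.coe_coe]
  rw [iterDeriv_rescale_neg_one, map_zsmul, map_zsmul, show -(-m - 1) - 1 = m by ring,
    constantCoeff_rescale_neg_one]
  simp only [zsmul_eq_mul]
  push_cast
  ring

/-- This turns the left action into right multiplication by the adjoint, so that the module axioms
reduce to the algebra of `adjoint` and `evalZero`. -/
theorem ofLaurent_act (P : PsDO) (f : LaurentSeries ℂ) :
    ofLaurent (act P f) = (ofLaurent f * P.adjoint).evalZero := by
  rw [act, ofLaurent_rho, adjoint_mul, adjoint_ofLaurent]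

theorem act_mul (P Q : PsDO) (f : LaurentSeries ℂ) : act (P * Q) f = act P (act Q f) := by
  apply ofLaurent_injective
  rw [ofLaurent_act, ofLaurent_act, ofLaurent_act, evalZero_evalZero_mul, adjoint_mul, mul_assoc]

theorem act_one (f : LaurentSeries ℂ) : act 1 f = f := by
  apply ofLaurent_injective
  rw [ofLaurent_act, adjoint_one, mul_one, evalZero_ofLaurent]

theorem act_add_left (P Q : PsDO) (f : LaurentSeries ℂ) : act (P + Q) f = act P f + act Q f := by
  apply ofLaurent_injective
  rw [ofLaurent_add, ofLaurent_act, ofLaurent_act, ofLaurent_act, adjoint_add, mul_add,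
    evalZero_add]

theorem act_add (P : PsDO) (f g : LaurentSeries ℂ) : act P (f + g) = act P f + act P g := by
  apply ofLaurent_injective
  rw [ofLaurent_add, ofLaurent_act, ofLaurent_act, ofLaurent_act, ofLaurent_add, add_mul,
    evalZero_add]

/-- An operator of order at most `0` preserves `ℂ⟦z⟧`. -/
theorem coeff_act_eq_zero {P : PsDO} (hP : ∀ k, 0 < k → P.coeff k = 0) {f : LaurentSeries ℂ}
    (hf : ∀ k : ℤ, k < 0 → f.coeff k = 0) (k : ℤ) (hk : k < 0) : (act P f).coeff k = 0 := by
  have h1 : ∀ k : ℤ, -1 < k → (ofLaurent f).coeff k = 0 := fun k hk => by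
    rw [coeff_ofLaurent, hf _ (by omega), map_zero]
  -- Power series correspond to operators of order at most `-1`, and right multiplication by `P*`,
  -- of order at most `0`, keeps that bound; here `-k - 1 ≥ 0`.
  have h2 : (ofLaurent (act P f)).coeff (-k - 1) = 0 := by
    rw [ofLaurent_act, coeff_evalZero,
      coeff_mul_eq_zero h1 (coeff_adjoint_eq_zero hP) _ (by omega), map_zero, map_zero]
  have h3 := congrArg (constantCoeff (R := ℂ)) h2
  simpa [coeff_ofLaurent] using h3

/-- The residue of an operator at `x = 0` is invariant under the adjoint. -/
theorem constantCoeff_coeff_adjoint_neg_one (P : PsDO) :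
    constantCoeff (P.adjoint.coeff (-1)) = constantCoeff (P.coeff (-1)) := by
  rw [coeff_adjoint, finsum_eq_single _ 0]
  · simp [iterDeriv_zero, constantCoeff_rescale_neg_one]
  · intro i hi
    -- For `i = j + 1` the weight is binom(j, j+1) = 0: the correction terms have no residue.
    obtain ⟨j, rfl⟩ := Nat.exists_eq_succ_of_ne_zero hi
    rw [show (-1 : ℤ) + (j.succ : ℕ) = (j : ℕ) by push_cast; ring, Ring.choose_natCast,
      Nat.choose_succ_self]
    simp

/-- The coefficient of `z⁻¹` in `f g`, in terms of operators. -/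
theorem coeff_neg_one_mul (f g : LaurentSeries ℂ) :
    (f * g).coeff (-1) = constantCoeff ((ofLaurent f * ofLaurent g).coeff (-1)) := by
  have h : (Function.support fun x : ℤ × ℕ => Ring.choose x.1 x.2 •
      (constantCoeff ((ofLaurent f).coeff x.1) *
        constantCoeff (iterDeriv x.2 ((ofLaurent g).coeff (-1 - x.1 + x.2))))).Finite :=
    (mulTerm_support (ofLaurent f) (ofLaurent g) (-1)).subset fun x hx hx' => hx (by
      have h := congrArg (constantCoeff (R := ℂ)) hx'
      rwa [mulTerm, map_zsmul, map_mul, map_zero] at h)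
  rw [constantCoeff_coeff_mul, finsum_curry _ h, LaurentSeries.coeff_mul_eq_finsum,
    -- The substitution `j = -k - 1` matches `z^j` with `∂^k`; constant coefficients leave only the
    -- underived term.
    ← finsum_comp_equiv ((Equiv.neg ℤ).trans (Equiv.subRight 1))]
  refine finsum_congr fun k => ?_
  rw [finsum_eq_single _ 0]
  · simp [iterDeriv_zero, coeff_ofLaurent, show -1 - (-k - 1) = k by ring]
  · intro i hi
    rw [coeff_ofLaurent _ (-1 - k + i), iterDeriv_C i hi, map_zero, mul_zero, smul_zero]

/-- The adjoint with respect to the pairing `(f, g) ↦ res (f g dz)`. -/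
theorem coeff_neg_one_act_mul (P : PsDO) (f g : LaurentSeries ℂ) :
    (act P f * g).coeff (-1) = (f * act P.adjoint g).coeff (-1) := by
  have key : ∀ (P : PsDO) (f g : LaurentSeries ℂ), (act P f * g).coeff (-1) =
      constantCoeff ((ofLaurent f * P.adjoint * ofLaurent g).coeff (-1)) := by
    intro P f g
    have h := congrArg (fun Q => constantCoeff (R := ℂ) (PsDO.coeff Q (-1)))
      (evalZero_evalZero_mul (ofLaurent f * P.adjoint) (ofLaurent g))
    simp only [coeff_evalZero, constantCoeff_C] at h
    rw [coeff_neg_one_mul, ofLaurent_act, h]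
  -- The two sides are the residues of `f P* g` and `g P** f`, and these operators are adjoint to
  -- each other.
  rw [key, mul_comm f, key, ← constantCoeff_coeff_adjoint_neg_one, adjoint_mul, adjoint_mul,
    adjoint_ofLaurent, adjoint_ofLaurent, mul_assoc]

end PsDO

/-! ### Passage to matrices and the group of monic operators of order zero. -/

namespace PsDO

theorem adjoint_sum {ι : Type*} (s : Finset ι) (P : ι → PsDO) :
    (∑ l ∈ s, P l).adjoint = ∑ l ∈ s, (P l).adjoint :=
  map_sum (AddMonoidHom.mk' adjoint adjoint_add) P s

theorem adjoint_zero : (0 : PsDO).adjoint = 0 :=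
  map_zero (AddMonoidHom.mk' adjoint adjoint_add)

theorem act_sum_left {ι : Type*} (s : Finset ι) (P : ι → PsDO) (f : LaurentSeries ℂ) :
    act (∑ l ∈ s, P l) f = ∑ l ∈ s, act (P l) f :=
  map_sum (AddMonoidHom.mk' (fun P : PsDO => act P f) fun P Q => act_add_left P Q f) P s

theorem act_sum {ι : Type*} (s : Finset ι) (P : PsDO) (f : ι → LaurentSeries ℂ) :
    act P (∑ l ∈ s, f l) = ∑ l ∈ s, act P (f l) :=
  map_sum (AddMonoidHom.mk' (act P) (act_add P)) f s

theorem act_zero_left (f : LaurentSeries ℂ) : act 0 f = 0 :=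
  map_zero (AddMonoidHom.mk' (fun P : PsDO => act P f) fun P Q => act_add_left P Q f)

theorem adjoint_partialX : partialX.adjoint = partialX := by
  rw [partialX_eq_monomial, adjoint_monomial, map_one]
  exact mul_one _

end PsDO

namespace MatPsDO

variable {n : ℕ}

theorem act_mul (P Q : MatPsDO n) (f : Fin n → LaurentSeries ℂ) :
    act (P * Q) f = act P (act Q f) := by
  funext i
  simp only [act, Matrix.mul_apply, PsDO.act_sum_left, PsDO.act_sum, PsDO.act_mul]
  exact Finset.sum_comm

theorem act_one (f : Fin n → LaurentSeries ℂ) : act 1 f = f := by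
  funext i
  rw [act, Finset.sum_eq_single i]
  · rw [Matrix.one_apply_eq, PsDO.act_one]
  · intro j _ hj
    rw [Matrix.one_apply_ne hj.symm, PsDO.act_zero_left]
  · simp

theorem act_add (P : MatPsDO n) (f g : Fin n → LaurentSeries ℂ) :
    act P (f + g) = act P f + act P g := by
  funext i
  simp [act, PsDO.act_add, Finset.sum_add_distrib]

theorem act_inverse_act {S : MatPsDO n} (hS : IsUnit S) (f : Fin n → LaurentSeries ℂ) :
    act (Ring.inverse S) (act S f) = f := by
  rw [← act_mul, Ring.inverse_mul_cancel S hS, act_one]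

theorem act_act_inverse {S : MatPsDO n} (hS : IsUnit S) (f : Fin n → LaurentSeries ℂ) :
    act S (act (Ring.inverse S) f) = f := by
  rw [← act_mul, Ring.mul_inverse_cancel S hS, act_one]

theorem adjoint_mul (P Q : MatPsDO n) : adjoint (P * Q) = adjoint Q * adjoint P := by
  ext1 i j
  simp only [adjoint, Matrix.of_apply, Matrix.mul_apply, PsDO.adjoint_sum, PsDO.adjoint_mul]

theorem adjoint_adjoint (P : MatPsDO n) : adjoint (adjoint P) = P := by
  ext1 i j
  simp only [adjoint, Matrix.of_apply, PsDO.adjoint_adjoint]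

theorem adjoint_diagonal_partialX :
    adjoint (Matrix.diagonal fun _ : Fin n => PsDO.partialX) =
      Matrix.diagonal fun _ => PsDO.partialX := by
  ext1 i j
  rw [adjoint, Matrix.of_apply]
  by_cases h : i = j
  · rw [h, Matrix.diagonal_apply_eq, PsDO.adjoint_partialX]
  · rw [Matrix.diagonal_apply_ne _ h, Matrix.diagonal_apply_ne' _ h, PsDO.adjoint_zero]

theorem adjoint_one : adjoint (1 : MatPsDO n) = 1 := by
  ext1 i j
  rw [adjoint, Matrix.of_apply]
  by_cases h : i = j
  · rw [h, Matrix.one_apply_eq, PsDO.adjoint_one]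
  · rw [Matrix.one_apply_ne h, Matrix.one_apply_ne' h, PsDO.adjoint_zero]

theorem adjoint_add (P Q : MatPsDO n) : adjoint (P + Q) = adjoint P + adjoint Q := by
  ext1 i j
  simp only [adjoint, Matrix.of_apply, Matrix.add_apply, PsDO.adjoint_add]

theorem ordLE_adjoint {d : ℤ} {P : MatPsDO n} (hP : ordLE d P) : ordLE d (adjoint P) :=
  fun i j => PsDO.coeff_adjoint_eq_zero (hP j i)

theorem ordLE_one : ordLE 0 (1 : MatPsDO n) := by
  intro i j k hk
  by_cases h : i = j
  · rw [h, Matrix.one_apply_eq, PsDO.coeff_one, if_neg hk.ne']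
  · rw [Matrix.one_apply_ne h, PsDO.coeff_zero]

theorem exists_ordLE (P : MatPsDO n) : ∃ d : ℕ, ordLE d P := by
  choose N hN using fun i j => (P i j).exists_bound
  refine ⟨∑ i, ∑ j, (N i j).toNat, fun i j k hk => hN i j k ?_⟩
  have h1 := Finset.single_le_sum (f := fun j => (N i j).toNat) (fun _ _ => Nat.zero_le _)
    (Finset.mem_univ j)
  have h2 := Finset.single_le_sum (f := fun i => ∑ j, (N i j).toNat) (fun _ _ => Nat.zero_le _)
    (Finset.mem_univ i)
  omega

theorem mem_monicZero_iff {S : MatPsDO n} : S ∈ monicZero n ↔ ∃ N, ordLE (-1) N ∧ S = 1 + N := by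
  constructor
  · intro h
    refine ⟨S - 1, fun i j k hk => ?_, by abel⟩
    rw [Matrix.sub_apply, PsDO.coeff_sub, h i j k (by omega), sub_self]
  · rintro ⟨N, hN, rfl⟩ i j k hk
    rw [Matrix.add_apply, PsDO.coeff_add, hN i j k (by omega), add_zero]

theorem ordLE_of_mem_monicZero {S : MatPsDO n} (hS : S ∈ monicZero n) : ordLE 0 S :=
  fun i j k hk => (hS i j k hk.le).trans (ordLE_one i j k hk)

theorem adjoint_mem_monicZero {S : MatPsDO n} (hS : S ∈ monicZero n) :
    adjoint S ∈ monicZero n := by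
  obtain ⟨N, hN, rfl⟩ := mem_monicZero_iff.1 hS
  exact mem_monicZero_iff.2 ⟨adjoint N, ordLE_adjoint hN, by rw [adjoint_add, adjoint_one]⟩

/-- The inverse `T` satisfies `T = 1 + (1 - S) T` with `1 - S` of order at most `-1`. This
bootstraps any a priori order bound on `T` down to `0`, and one more use shows that `T - 1` has
order at most `-1`. -/
theorem inverse_mem_monicZero {S : MatPsDO n} (hS : S ∈ monicZero n) :
    Ring.inverse S ∈ monicZero n := by
  have hu := isUnit_of_mem_monicZero hS
  set T := Ring.inverse S with hT
  have e : T = 1 + (1 - S) * T := by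
    rw [sub_mul, hT, Ring.mul_inverse_cancel S hu, one_mul]; abel
  have key : ∀ d : ℕ, ordLE d T → ordLE 0 T := by
    intro d
    induction d with
    | zero => exact id
    | succ d ih =>
      refine fun h => ih fun i j k hk => ?_
      rw [e, Matrix.add_apply, PsDO.coeff_add, ordLE_one i j k (by omega),
        ordLE_mul (sub_one_mem hS) h i j k (by push_cast; omega), add_zero]
  obtain ⟨d, hd⟩ := exists_ordLE T
  exact mem_monicZero_iff.2 ⟨_, ordLE_mul (sub_one_mem hS) (key d hd), e⟩

end MatPsDO

theorem Ring.inverse_inverse_of_isUnit {M : Type*} [MonoidWithZero M] {a : M} (ha : IsUnit a) :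
    Ring.inverse (Ring.inverse a) = a := by
  obtain ⟨u, rfl⟩ := ha
  rw [Ring.inverse_unit, Ring.inverse_unit, inv_inv]

namespace MatPsDO

variable {n : ℕ}

theorem inverse_adjoint {S : MatPsDO n} (hS : S ∈ monicZero n) :
    Ring.inverse (adjoint S) = adjoint (Ring.inverse S) := by
  have hu := isUnit_of_mem_monicZero hS
  have hu' := isUnit_of_mem_monicZero (adjoint_mem_monicZero hS)
  calc Ring.inverse (adjoint S)
      = Ring.inverse (adjoint S) * (adjoint S * adjoint (Ring.inverse S)) := by
        rw [← adjoint_mul, Ring.inverse_mul_cancel S hu, adjoint_one, mul_one]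
    _ = adjoint (Ring.inverse S) := by
        rw [← mul_assoc, Ring.inverse_mul_cancel _ hu', one_mul]

/-- Reversing `S ∂ S⁻¹` puts the adjoint of `S⁻¹` on the left; it equals `(S*)⁻¹`, while `∂` is
self-adjoint. -/
theorem adjoint_lax {S : MatPsDO n} (hS : S ∈ monicZero n) :
    adjoint (lax S) = lax (Ring.inverse (adjoint S)) := by
  have hu := isUnit_of_mem_monicZero (adjoint_mem_monicZero hS)
  rw [lax, lax, adjoint_mul, adjoint_mul, adjoint_diagonal_partialX, ← inverse_adjoint hS,
    Ring.inverse_inverse_of_isUnit hu, mul_assoc]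

end MatPsDO

/-! ### Orthogonal complements and the big cell. -/

namespace SatoGrassmannian

variable {n : ℕ}

/-- The scalar transpose rule holds entrywise, and exchanging the two summations accounts for the
matrix transpose. -/
theorem pairing_act (P : MatPsDO n) (f g : Ambient n) :
    pairing (MatPsDO.act P f) g = pairing f (MatPsDO.act (MatPsDO.adjoint P) g) := by
  simp only [pairing, MatPsDO.act, Finset.sum_mul, Finset.mul_sum, HahnSeries.coeff_sum,
    MatPsDO.adjoint, Matrix.of_apply, PsDO.coeff_neg_one_act_mul]
  exact Finset.sum_comm

theorem act_mem_nonneg {S : MatPsDO n} (hS : S ∈ MatPsDO.monicZero n) {f : Ambient n}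
    (hf : f ∈ nonneg n) : MatPsDO.act S f ∈ nonneg n := by
  intro i k hk
  rw [MatPsDO.act, HahnSeries.coeff_sum]
  exact Finset.sum_eq_zero fun j _ =>
    PsDO.coeff_act_eq_zero (MatPsDO.ordLE_of_mem_monicZero hS i j) (hf j) k hk

theorem neg_inf_nonneg {f : Ambient n} (h1 : f ∈ neg n) (h2 : f ∈ nonneg n) : f = 0 := by
  funext i
  ext k
  rcases lt_or_ge k 0 with hk | hk
  · exact h2 i k hk
  · exact h1 i k hk

theorem exists_neg_add_nonneg (f : Ambient n) : ∃ g ∈ neg n, ∃ h ∈ nonneg n, f = g + h := by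
  let h : Ambient n := fun i => HahnSeries.ofSuppBddBelow
    (fun k : ℤ => if k < 0 then 0 else (f i).coeff k)
    ⟨0, fun k hk => by by_contra hk'; exact hk (if_pos (not_le.1 hk'))⟩
  have hh : ∀ i k, (h i).coeff k = if k < 0 then 0 else (f i).coeff k := fun _ _ => rfl
  refine ⟨f - h, fun i k hk => ?_, h, fun i k hk => by rw [hh, if_pos hk], by abel⟩
  rw [Pi.sub_apply, HahnSeries.coeff_sub, hh, if_neg (not_lt.2 hk), sub_self]

theorem perp_neg : perp (neg n) = neg n := by
  ext f
  constructor
  · intro hf i k hk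
    -- Pairing with `z^(-1-k)` in slot `i` extracts the coefficient of `z^k`; for `k ≥ 0` this test
    -- vector has negative degree.
    have h := hf (Pi.single i (HahnSeries.single (-1 - k) 1)) (fun j l hl => by
      by_cases hj : j = i
      · subst hj
        rw [Pi.single_eq_same, HahnSeries.coeff_single_of_ne (by omega)]
      · rw [Pi.single_eq_of_ne hj]; rfl)
    rw [pairing, Finset.sum_eq_single i] at h
    · rw [Pi.single_eq_same] at h
      have h' := HahnSeries.coeff_mul_single_add (r := (1 : ℂ)) (x := f i) (a := k) (b := -1 - k)
      rw [show k + (-1 - k) = -1 by ring, h, mul_one] at h'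
      exact h'.symm
    · intro j _ hj
      rw [Pi.single_eq_of_ne hj, mul_zero]; rfl
    · simp
  · intro hf w hw
    refine Finset.sum_eq_zero fun i _ => ?_
    rw [LaurentSeries.coeff_mul_eq_finsum, ← finsum_zero (α := ℤ)]
    refine finsum_congr fun j => ?_
    -- One of `j` and `-1 - j` is always nonnegative, so one factor vanishes.
    rcases lt_or_ge j 0 with hj | hj
    · rw [hw i _ (by omega), mul_zero]
    · rw [hf i j hj, zero_mul]

/-- Both `S` and `S⁻¹` preserve `ℂ⟦z⟧^n`, so `S⁻¹` carries the splitting of the ambient space into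
`neg n` and `nonneg n` to a splitting into `W` and `nonneg n`. -/
theorem Corresponds.mem_bigCell {W : Submodule ℂ (Ambient n)} {S : MatPsDO n}
    (h : Corresponds W S) : W ∈ bigCell n := by
  obtain ⟨hS, hW⟩ := h
  have hu := MatPsDO.isUnit_of_mem_monicZero hS
  have hinj : Function.Injective (gamma W) := by
    rw [injective_iff_map_eq_zero]
    rintro ⟨w, hw⟩ h0
    have hw1 : w ∈ nonneg n := (Submodule.Quotient.mk_eq_zero _).1 h0
    have hw2 : w ∈ MatPsDO.act (Ring.inverse S) '' (neg n : Set (Ambient n)) := hW ▸ hw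
    obtain ⟨g, hg, rfl⟩ := hw2
    have hg1 := act_mem_nonneg hS hw1
    rw [MatPsDO.act_act_inverse hu] at hg1
    have hz : g = 0 := neg_inf_nonneg hg hg1
    have h3 := MatPsDO.act_add (Ring.inverse S) 0 0
    rw [add_zero, left_eq_add] at h3
    subst hz
    exact Subtype.ext h3
  have hsurj : Function.Surjective (gamma W) := by
    intro q
    obtain ⟨f, rfl⟩ := Submodule.Quotient.mk_surjective _ q
    -- Split `S f` as `g + h`; then `S⁻¹ g` lies in `W` and differs from `f` by `S⁻¹ h`, which is in
    -- `nonneg n`.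
    obtain ⟨g, hg, h, hh, e⟩ := exists_neg_add_nonneg (MatPsDO.act S f)
    have hg' : MatPsDO.act (Ring.inverse S) g ∈ (W : Set (Ambient n)) := hW ▸ ⟨g, hg, rfl⟩
    refine ⟨⟨_, hg'⟩, (Submodule.Quotient.eq _).2 ?_⟩
    have e2 := congrArg (MatPsDO.act (Ring.inverse S)) e
    rw [MatPsDO.act_inverse_act hu, MatPsDO.act_add] at e2
    have e3 : MatPsDO.act (Ring.inverse S) g - f = -MatPsDO.act (Ring.inverse S) h := by
      rw [e2]; abel
    exact e3 ▸ neg_mem (act_mem_nonneg (MatPsDO.inverse_mem_monicZero hS) hh)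
  refine ⟨⟨?_, ?_⟩, hinj, hsurj⟩
  · have hk : LinearMap.ker (gamma W) = ⊥ := (Submodule.eq_bot_iff _).2 fun x hx =>
      hinj ((LinearMap.mem_ker.1 hx).trans (map_zero (gamma W)).symm)
    rw [hk]
    infer_instance
  · rw [LinearMap.range_eq_top.2 hsurj]
    infer_instance

theorem Corresponds.perp {W : Submodule ℂ (Ambient n)} {S : MatPsDO n}
    (h : Corresponds W S) : Corresponds (perp W) (Ring.inverse (MatPsDO.adjoint S)) := by
  obtain ⟨hS, hW⟩ := h
  have hS' := MatPsDO.adjoint_mem_monicZero hS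
  have hu' := MatPsDO.isUnit_of_mem_monicZero hS'
  refine ⟨MatPsDO.inverse_mem_monicZero hS', ?_⟩
  rw [Ring.inverse_inverse_of_isUnit hu']
  -- Moving `S⁻¹` across the pairing turns orthogonality of `f` to `W` into orthogonality of `(S*)⁻¹
  -- f` to `neg n`, and `neg n` is its own complement.
  have hmem : ∀ f, f ∈ SatoGrassmannian.perp W ↔
      MatPsDO.act (Ring.inverse (MatPsDO.adjoint S)) f ∈ neg n := by
    intro f
    have hp : ∀ g, pairing f (MatPsDO.act (Ring.inverse S) g) =
        pairing (MatPsDO.act (Ring.inverse (MatPsDO.adjoint S)) f) g := fun g => by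
      rw [pairing_act, MatPsDO.inverse_adjoint hS, MatPsDO.adjoint_adjoint]
    rw [← perp_neg]
    constructor
    · intro hf g hg
      have hw : MatPsDO.act (Ring.inverse S) g ∈ (W : Set (Ambient n)) := hW ▸ ⟨g, hg, rfl⟩
      rw [← hp]
      exact hf _ hw
    · intro hf w hw
      have hw' : w ∈ MatPsDO.act (Ring.inverse S) '' (neg n : Set (Ambient n)) := hW ▸ hw
      obtain ⟨g, hg, rfl⟩ := hw'
      rw [hp]
      exact hf g hg
  ext f
  constructor
  · intro hf
    exact ⟨_, (hmem f).1 hf, MatPsDO.act_act_inverse hu' f⟩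
  · rintro ⟨g, hg, rfl⟩
    refine (hmem _).2 ?_
    rw [MatPsDO.act_inverse_act hu']
    exact hg

end SatoGrassmannian

end

theorem mainTheorem7 (n : ℕ) (hn : 0 < n) :
    (∀ W : Submodule ℂ (SatoGrassmannian.Ambient n), W ∈ SatoGrassmannian.bigCell n →
      ∀ S : MatPsDO n, SatoGrassmannian.Corresponds W S →
        SatoGrassmannian.perp W ∈ SatoGrassmannian.bigCell n ∧
        IsUnit (MatPsDO.adjoint S) ∧
        Ring.inverse (MatPsDO.adjoint S) ∈ MatPsDO.monicZero n ∧
        SatoGrassmannian.Corresponds (SatoGrassmannian.perp W) (Ring.inverse (MatPsDO.adjoint S))) ∧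
    (∀ w : SatoGrassmannian.OrbitSpace n, w ∈ SatoGrassmannian.bigCellZ n →
      ∀ L : MatPsDO n, SatoGrassmannian.LaxCorresponds w L →
        SatoGrassmannian.perpZ w ∈ SatoGrassmannian.bigCellZ n ∧ SatoGrassmannian.LaxCorresponds (SatoGrassmannian.perpZ w) (MatPsDO.adjoint L)) := by
  refine ⟨fun W _ S h => ⟨h.perp.mem_bigCell,
    MatPsDO.isUnit_of_mem_monicZero (MatPsDO.adjoint_mem_monicZero h.1), h.perp.1, h.perp⟩, ?_⟩
  -- Work with the representative `W` supplied by the Lax correspondence: the orbit of `perp W` is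
  -- `perpZ` of its orbit by definition.
  rintro _ _ _ ⟨W, _, S, h, rfl, rfl⟩
  exact ⟨⟨_, h.perp.mem_bigCell, rfl⟩,
    _, h.perp.mem_bigCell, _, h.perp, rfl, MatPsDO.adjoint_lax h.1⟩
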